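/- Let $X$ be a spacetime, that is, a Hausdorff, second countable smooth manifold without boundary (of any finite dimension) with a Lorentzian metric $g$ of signature $(-,+,\dots,+)$ and of class $C^k$, where $1\le k\le\infty$, and a time orientation given by a continuous timelike vector field. Timelike and causal curves are piecewise $C^1$ and future-directed (with nowhere vanishing one-sided velocities). For $x \in X$ let $I^-(x)$ be the set of all $p\in X$ from which there is a timelike curve to $x$. The future boundary of a subset $A\subseteq X$ is $$\partial^+A=\{x\in\overline A\setminus A \mid I^-(x)\cap A\neq\emptyset\}.$$ The set $A$ is called causally convex if no causal curve in $X$ leaves and re-enters $A$, i.e. there are no causal curve $c$ and parameters $t_1<t_2<t_3$ with $c(t_1)\in A$, $c(t_2)\notin A$, $c(t_3)\in A$. A subset $S \subseteq X$ is called achronal if there is no timelike curve from a point of $S$ to a point of $S$. **Theorem.** Let $A\subseteq X$ be open and precompact (i.e. $\overline A$ is compact). 1. If $A$ is causally convex, then $\partial^+A$ is achronal. 2. If $X$ is chronological (i.e. contains no closed timelike curve; this holds for instance if $X$ is globally hyperbolic), then $A$ is causally convex if and only if $\partial^+A$ is achronal. -/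

import Mathlib

open Set Bundle
open scoped Manifold ContDiff

noncomputable section

/-- A Lorentzian metric of class `C^k` and signature `(-, +, ..., +)` on an `n`-dimensional smooth
manifold `M`: a symmetric bilinear form on every tangent space, depending `C^k` on the base point,
for which there is a timelike vector, and which is positive definite on the orthogonal complement
of every timelike vector. -/
structure LorentzianMetric (n : ℕ) (k : ℕ∞) (M : Type*) [TopologicalSpace M]
    [ChartedSpace (EuclideanSpace ℝ (Fin n)) M] [IsManifold (𝓡 n) ∞ M] where
  /-- the scalar product on the tangent space at `x` -/
  inner (x : M) : TangentSpace (𝓡 n) x →L[ℝ] TangentSpace (𝓡 n) x →L[ℝ] ℝ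
  symm (x : M) (v w : TangentSpace (𝓡 n) x) : inner x v w = inner x w v
  exists_timelike (x : M) : ∃ v : TangentSpace (𝓡 n) x, inner x v v < 0
  pos_of_orthogonal (x : M) (v w : TangentSpace (𝓡 n) x) :
    inner x v v < 0 → inner x v w = 0 → w ≠ 0 → 0 < inner x w w
  contMDiff : ContMDiff (𝓡 n)
    ((𝓡 n).prod 𝓘(ℝ, EuclideanSpace ℝ (Fin n) →L[ℝ] EuclideanSpace ℝ (Fin n) →L[ℝ] ℝ)) k
    (fun x ↦ TotalSpace.mk' (EuclideanSpace ℝ (Fin n) →L[ℝ] EuclideanSpace ℝ (Fin n) →L[ℝ] ℝ)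
      (E := fun x : M ↦ TangentSpace (𝓡 n) x →L[ℝ] TangentSpace (𝓡 n) x →L[ℝ] ℝ) x (inner x))

/-- A spacetime structure on a smooth manifold: a Lorentzian metric together with a time
orientation, given by a continuous vector field `T` that is everywhere timelike and is declared
to be future-directed. -/
structure SpacetimeStructure (n : ℕ) (k : ℕ∞) (M : Type*) [TopologicalSpace M]
    [ChartedSpace (EuclideanSpace ℝ (Fin n)) M] [IsManifold (𝓡 n) ∞ M] where
  /-- the Lorentzian metric -/
  g : LorentzianMetric n k M
  /-- the time-orienting vector field -/
  T (x : M) : TangentSpace (𝓡 n) x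
  continuous_T : Continuous (fun x ↦ (⟨x, T x⟩ : TangentBundle (𝓡 n) M))
  timelike_T (x : M) : g.inner x (T x) (T x) < 0

namespace SpacetimeStructure

variable {n : ℕ} {k : ℕ∞} {M : Type*} [TopologicalSpace M]
  [ChartedSpace (EuclideanSpace ℝ (Fin n)) M] [IsManifold (𝓡 n) ∞ M]

/-- A tangent vector is future-directed timelike: `g(v, v) < 0`, and `v` is in the same half of the
cone as `T`. -/
def FutureTimelike (X : SpacetimeStructure n k M) (x : M) (v : TangentSpace (𝓡 n) x) : Prop :=
  X.g.inner x v v < 0 ∧ X.g.inner x (X.T x) v < 0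

/-- A tangent vector is future-directed causal: it is nonzero, `g(v, v) ≤ 0`, and `v` is in the same
half of the cone as `T`. -/
def FutureCausal (X : SpacetimeStructure n k M) (x : M) (v : TangentSpace (𝓡 n) x) : Prop :=
  v ≠ 0 ∧ X.g.inner x v v ≤ 0 ∧ X.g.inner x (X.T x) v < 0

/-- `γ` restricted to `[a, b]`, where `a < b`, is a continuous and piecewise `C^1` curve whose
velocity vectors all satisfy `P`; at the finitely many break points `t i`, and at the end points,
this refers to the one-sided velocities. -/
def IsPiecewiseC1Curve (n : ℕ) {M : Type*} [TopologicalSpace M]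
    [ChartedSpace (EuclideanSpace ℝ (Fin n)) M]
    (P : ∀ x : M, TangentSpace (𝓡 n) x → Prop) (γ : ℝ → M) (a b : ℝ) : Prop :=
  a < b ∧ ContinuousOn γ (Icc a b) ∧
    ∃ (m : ℕ) (t : ℕ → ℝ), StrictMono t ∧ t 0 = a ∧ t m = b ∧
      ∀ i < m, ContMDiffOn 𝓘(ℝ, ℝ) (𝓡 n) 1 γ (Icc (t i) (t (i + 1))) ∧
        ∀ s ∈ Icc (t i) (t (i + 1)),
          P (γ s) (mfderivWithin 𝓘(ℝ, ℝ) (𝓡 n) γ (Icc (t i) (t (i + 1))) s (1 : ℝ))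

/-- `γ` is a future-directed timelike curve on `[a, b]`. -/
def IsTimelikeCurve (X : SpacetimeStructure n k M) (γ : ℝ → M) (a b : ℝ) : Prop :=
  IsPiecewiseC1Curve n X.FutureTimelike γ a b

/-- `γ` is a future-directed causal curve on `[a, b]`. -/
def IsCausalCurve (X : SpacetimeStructure n k M) (γ : ℝ → M) (a b : ℝ) : Prop :=
  IsPiecewiseC1Curve n X.FutureCausal γ a b

/-- The chronological relation: there is a future-directed timelike curve from `p` to `q`. -/
def Chron (X : SpacetimeStructure n k M) (p q : M) : Prop :=
  ∃ (γ : ℝ → M) (a b : ℝ), X.IsTimelikeCurve γ a b ∧ γ a = p ∧ γ b = q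

/-- The chronological past `I⁻(x)`. -/
def chronPast (X : SpacetimeStructure n k M) (x : M) : Set M :=
  {p | X.Chron p x}

/-- The spacetime has no closed timelike curves. -/
def IsChronological (X : SpacetimeStructure n k M) : Prop :=
  ∀ p : M, ¬ X.Chron p p

/-- No two points of `S`, distinct or not, are joined by a timelike curve. -/
def IsAchronal (X : SpacetimeStructure n k M) (S : Set M) : Prop :=
  ∀ p ∈ S, ∀ q ∈ S, ¬ X.Chron p q

/-- No causal curve leaves and re-enters `A`. (Reversing a curve shows that it does not matter
whether past-directed causal curves are considered as well.) -/
def IsCausallyConvex (X : SpacetimeStructure n k M) (A : Set M) : Prop :=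
  ¬ ∃ (γ : ℝ → M) (a b : ℝ), X.IsCausalCurve γ a b ∧
    ∃ t₁ ∈ Icc a b, ∃ t₂ ∈ Icc a b, ∃ t₃ ∈ Icc a b,
      t₁ < t₂ ∧ t₂ < t₃ ∧ γ t₁ ∈ A ∧ γ t₂ ∉ A ∧ γ t₃ ∈ A

/-- The future boundary `∂⁺A = {x ∈ closure A \ A | I⁻(x) ∩ A ≠ ∅}`. -/
def futureBoundary (X : SpacetimeStructure n k M) (A : Set M) : Set M :=
  {x | x ∈ closure A \ A ∧ (X.chronPast x ∩ A).Nonempty}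

end SpacetimeStructure

end

/-! Write `p ≪ q` for `X.Chron p q`. Two facts carry the proof. The sets `I⁺(p)` and `I⁻(q)` are
open (`Chron.mem_nhds_right`, `Chron.mem_nhds_left`). A timelike curve followed or preceded by a
causal one can be replaced by a timelike curve (`C1Joined.push_up`).

Convexity implies achronality: let `x ≪ y` in `∂⁺A`, and let `p ∈ A` with `p ≪ x`. Since `y ∈
closure A` and `I⁺(x)` is a neighbourhood of `y`, some `q ∈ A` satisfies `x ≪ q`. The curve from `p`
through `x ∉ A` to `q` contradicts convexity.

Conversely, let a causal curve leave `A`, with first exit point `x`, and return to `A`. Points `p, q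
∈ A` slightly before the start and slightly after the return satisfy `p ≪ x ≪ q`, so `x ∈ ∂⁺A`. If
`I⁺(q)` were contained in `A`, its compact closure would be covered by finitely many `I⁻(w)` with `q
≪ w`; each such `w` precedes another one, which forces a closed timelike curve. Hence some timelike
curve from `q` exits `A`, at a point `y ∈ ∂⁺A`, and `x ≪ q ≪ y` contradicts achronality.

Both facts come from adding small affine functions to curves in a chart. For push-up, a displacement
`ε (s - r) τ`, with `τ` representing `T`, changes `g(v, v)` by about `2 ε g(T, v) < 0`; the change
of base point contributes only `ε O(s - r)`. This needs a `C^1` metric and no geodesics. -/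

open Filter Topology Relation

noncomputable section

namespace SpacetimeStructure

/-! ### Tangent vectors and the metric in a chart -/

section

variable {n : ℕ} {k : ℕ∞} {M : Type*} [TopologicalSpace M]
  [ChartedSpace (EuclideanSpace ℝ (Fin n)) M] [IsManifold (𝓡 n) ∞ M]

/-- The tangent vector at `φ⁻¹ y` with coordinates `w`, where `φ` is the preferred chart at `x₀`. -/
def chartVec (x₀ : M) (y w : EuclideanSpace ℝ (Fin n)) :
    TangentSpace (𝓡 n) ((extChartAt (𝓡 n) x₀).symm y) :=
  (trivializationAt (EuclideanSpace ℝ (Fin n)) (TangentSpace (𝓡 n)) x₀).symmL ℝ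
    ((extChartAt (𝓡 n) x₀).symm y) w

/-- A condition on tangent vectors, read in the preferred chart at `x₀`. -/
def InChart (P : ∀ x : M, TangentSpace (𝓡 n) x → Prop) (x₀ : M)
    (y w : EuclideanSpace ℝ (Fin n)) : Prop :=
  P ((extChartAt (𝓡 n) x₀).symm y) (chartVec x₀ y w)

lemma chartVec_eq_mfderiv (x₀ : M) {y : EuclideanSpace ℝ (Fin n)}
    (hy : y ∈ (extChartAt (𝓡 n) x₀).target) (w : EuclideanSpace ℝ (Fin n)) :
    chartVec x₀ y w = mfderiv 𝓘(ℝ, EuclideanSpace ℝ (Fin n)) (𝓡 n)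
      (extChartAt (𝓡 n) x₀).symm y w := by
  have hx : (extChartAt (𝓡 n) x₀).symm y ∈ (chartAt (EuclideanSpace ℝ (Fin n)) x₀).source := by
    simpa using (extChartAt (𝓡 n) x₀).map_target hy
  have : IsManifold (𝓡 n) 1 M := IsManifold.of_le (n := ∞) (by simp)
  have := TangentBundle.symmL_trivializationAt (I := 𝓡 n) hx
  rw [(extChartAt (𝓡 n) x₀).right_inv hy] at this
  unfold chartVec
  rw [this]
  simp only [modelWithCornersSelf_coe, range_id, mfderivWithin_univ]
  rfl

lemma exists_chartVec_eq (x₀ : M) {y : EuclideanSpace ℝ (Fin n)}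
    (hy : y ∈ (extChartAt (𝓡 n) x₀).target)
    (v : TangentSpace (𝓡 n) ((extChartAt (𝓡 n) x₀).symm y)) : ∃ w, chartVec x₀ y w = v := by
  have : IsManifold (𝓡 n) 1 M := IsManifold.of_le (n := ∞) (by simp)
  refine ⟨(trivializationAt (EuclideanSpace ℝ (Fin n)) (TangentSpace (𝓡 n))
    x₀).continuousLinearMapAt ℝ _ v, Trivialization.symmL_continuousLinearMapAt _ ?_ v⟩
  simpa using (extChartAt (𝓡 n) x₀).map_target hy

lemma contMDiffOn_chartVec (x₀ : M) :
    ContMDiffOn (𝓘(ℝ, EuclideanSpace ℝ (Fin n) × EuclideanSpace ℝ (Fin n)))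
      ((𝓡 n).prod 𝓘(ℝ, EuclideanSpace ℝ (Fin n))) 1
      (fun p : EuclideanSpace ℝ (Fin n) × EuclideanSpace ℝ (Fin n) ↦
        (⟨(extChartAt (𝓡 n) x₀).symm p.1, chartVec x₀ p.1 p.2⟩ : TangentBundle (𝓡 n) M))
      ((extChartAt (𝓡 n) x₀).target ×ˢ univ) := by
  have : IsManifold (𝓡 n) 1 M := IsManifold.of_le (n := ∞) (by simp)
  have : IsManifold (𝓡 n) (1 + 1) M := IsManifold.of_le (n := ∞) (by norm_cast)
  have h1 := (trivializationAt (EuclideanSpace ℝ (Fin n))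
    (TangentSpace (𝓡 n) (M := M)) x₀).contMDiffOn_symm
    (n := 1) (IB := 𝓡 n)
  have h2 : ContMDiffOn (𝓘(ℝ, EuclideanSpace ℝ (Fin n) × EuclideanSpace ℝ (Fin n)))
      ((𝓡 n).prod 𝓘(ℝ, EuclideanSpace ℝ (Fin n))) 1
      (fun p : EuclideanSpace ℝ (Fin n) × EuclideanSpace ℝ (Fin n) ↦
        ((extChartAt (𝓡 n) x₀).symm p.1, p.2)) ((extChartAt (𝓡 n) x₀).target ×ˢ univ) := by
    refine ContMDiffOn.prodMk ?_ contDiff_snd.contMDiff.contMDiffOn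
    have := (contMDiffOn_extChartAt_symm (I := 𝓡 n) (n := 1) x₀)
    exact this.comp contDiff_fst.contMDiff.contMDiffOn (fun p hp ↦ hp.1)
  have hb : ∀ y ∈ (extChartAt (𝓡 n) x₀).target, (extChartAt (𝓡 n) x₀).symm y ∈
     (trivializationAt (EuclideanSpace ℝ (Fin n)) (TangentSpace (𝓡 n)) x₀).baseSet := by
    intro y hy
    simpa using (extChartAt (𝓡 n) x₀).map_target hy
  refine (h1.comp h2 ?_).congr ?_
  · intro p hp
    rw [mem_preimage, Trivialization.target_eq]
    exact ⟨hb _ hp.1, mem_univ _⟩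
  · intro p hp
    rw [chartVec, Trivialization.symmL_apply _ (hb _ hp.1)]
    exact (Trivialization.mk_symm _ (hb _ hp.1) p.2)

/-- `g(w, w)` in the preferred chart at `x₀`. -/
def chartQuad (X : SpacetimeStructure n k M) (x₀ : M)
    (p : EuclideanSpace ℝ (Fin n) × EuclideanSpace ℝ (Fin n)) : ℝ :=
  X.g.inner _ (chartVec x₀ p.1 p.2) (chartVec x₀ p.1 p.2)

/-- `g(T, w)` in the preferred chart at `x₀`. -/
def chartTime (X : SpacetimeStructure n k M) (x₀ : M)
    (p : EuclideanSpace ℝ (Fin n) × EuclideanSpace ℝ (Fin n)) : ℝ :=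
  X.g.inner _ (X.T _) (chartVec x₀ p.1 p.2)

omit [IsManifold (𝓡 n) ∞ M] in
lemma isOpen_target_prod (x₀ : M) :
    IsOpen ((extChartAt (𝓡 n) x₀).target ×ˢ (univ : Set (EuclideanSpace ℝ (Fin n)))) :=
  (isOpen_extChartAt_target x₀).prod isOpen_univ

/-- Differentiability in the base point as well as in the vector is needed, because the push-up
displaces both. For `chartTime` continuity is enough: only the openness of its sign condition
matters. -/
lemma contDiffOn_chartQuad (hk : 1 ≤ k) (X : SpacetimeStructure n k M) (x₀ : M) :
    ContDiffOn ℝ 1 (X.chartQuad x₀) ((extChartAt (𝓡 n) x₀).target ×ˢ univ) := by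
  have : IsManifold (𝓡 n) 1 M := IsManifold.of_le (n := ∞) (by simp)
  have : IsManifold (𝓡 n) (1 + 1) M := IsManifold.of_le (n := ∞) (by norm_cast)
  rw [← contMDiffOn_iff_contDiffOn]
  have hs := (contMDiffOn_extChartAt_symm (I := 𝓡 n) (n := 1) x₀).comp
    (contDiff_fst (𝕜 := ℝ) (E := EuclideanSpace ℝ (Fin n))
      (F := EuclideanSpace ℝ (Fin n))).contMDiff.contMDiffOn
    (s := (extChartAt (𝓡 n) x₀).target ×ˢ univ) (fun p hp ↦ hp.1)
  have hg := (X.g.contMDiff.of_le (m := 1) (by exact_mod_cast hk)).comp_contMDiffOn hs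
  have hv := contMDiffOn_chartVec (n := n) x₀
  have := ContMDiffOn.clm_bundle_apply₂ (F₁ := EuclideanSpace ℝ (Fin n))
    (F₂ := EuclideanSpace ℝ (Fin n)) (F₃ := ℝ) (E₁ := TangentSpace (𝓡 n)) (E₂ := TangentSpace (𝓡 n))
    (E₃ := Bundle.Trivial M ℝ) hg hv hv
  intro p hp
  have := this p hp
  simp only [contMDiffWithinAt_totalSpace] at this
  exact this.2

lemma continuousOn_chartTime (X : SpacetimeStructure n k M) (x₀ : M) :
    ContinuousOn (X.chartTime x₀) ((extChartAt (𝓡 n) x₀).target ×ˢ univ) := by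
  have : IsManifold (𝓡 n) 1 M := IsManifold.of_le (n := ∞) (by simp)
  have hs : ContinuousOn (fun p : EuclideanSpace ℝ (Fin n) × EuclideanSpace ℝ (Fin n) ↦
      (extChartAt (𝓡 n) x₀).symm p.1) ((extChartAt (𝓡 n) x₀).target ×ˢ univ) :=
    (continuousOn_extChartAt_symm x₀).comp continuous_fst.continuousOn (fun p hp ↦ hp.1)
  have hg := X.g.contMDiff.continuous.comp_continuousOn hs
  have hT := X.continuous_T.comp_continuousOn hs
  have hv := (contMDiffOn_chartVec (n := n) x₀).continuousOn
  have := ContinuousOn.clm_bundle_apply₂ (F₁ := EuclideanSpace ℝ (Fin n))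
    (F₂ := EuclideanSpace ℝ (Fin n)) (F₃ := ℝ) (E₁ := TangentSpace (𝓡 n)) (E₂ := TangentSpace (𝓡 n))
    (E₃ := Bundle.Trivial M ℝ) hg hT hv
  intro p hp
  have := this p hp
  simp only [FiberBundle.continuousWithinAt_totalSpace] at this
  exact this.2

end

section

/-! ### Piecewise `C^1` curves as chains of `C^1` pieces -/

section Curves

variable {n : ℕ} {M : Type*} [TopologicalSpace M] [ChartedSpace (EuclideanSpace ℝ (Fin n)) M]
  {P : ∀ x : M, TangentSpace (𝓡 n) x → Prop} {γ η : ℝ → M} {a b u v : ℝ} {p q : M}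

/-- `γ` restricted to `[a, b]` is a `C^1` curve whose velocity vectors all satisfy `P`. -/
def IsC1Curve (n : ℕ) {M : Type*} [TopologicalSpace M]
    [ChartedSpace (EuclideanSpace ℝ (Fin n)) M]
    (P : ∀ x : M, TangentSpace (𝓡 n) x → Prop) (γ : ℝ → M) (a b : ℝ) : Prop :=
  ContMDiffOn 𝓘(ℝ, ℝ) (𝓡 n) 1 γ (Icc a b) ∧
    ∀ s ∈ Icc a b, P (γ s) (mfderivWithin 𝓘(ℝ, ℝ) (𝓡 n) γ (Icc a b) s (1 : ℝ))

/-- `p` and `q` are joined by a single `C^1` curve whose velocity vectors all satisfy `P`. -/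
def C1Joined (n : ℕ) {M : Type*} [TopologicalSpace M]
    [ChartedSpace (EuclideanSpace ℝ (Fin n)) M]
    (P : ∀ x : M, TangentSpace (𝓡 n) x → Prop) (p q : M) : Prop :=
  ∃ (γ : ℝ → M) (a b : ℝ), a < b ∧ IsC1Curve n P γ a b ∧ γ a = p ∧ γ b = q

lemma uniqueMDiffWithinAt_Icc (h : a < b) {s : ℝ} (hs : s ∈ Icc a b) :
    UniqueMDiffWithinAt 𝓘(ℝ, ℝ) (Icc a b) s :=
  (uniqueDiffOn_Icc h s hs).uniqueMDiffWithinAt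

lemma IsC1Curve.congr (h : IsC1Curve n P γ a b) (he : EqOn η γ (Icc a b)) :
    IsC1Curve n P η a b := by
  refine ⟨h.1.congr he, fun s hs ↦ ?_⟩
  -- The type of the velocity depends on the base point, so the two velocities are compared as
  -- elements of the tangent bundle.
  have h1 := tangentMapWithin_congr (I := 𝓘(ℝ, ℝ)) (I' := 𝓡 n) he ⟨s, (1 : ℝ)⟩ hs
  have h2 := congrArg (fun z : TangentBundle (𝓡 n) M ↦ P z.1 z.2) h1
  exact h2.mpr (h.2 s hs)

lemma IsC1Curve.mono (h : IsC1Curve n P γ a b) (huv : u < v) (hs : Icc u v ⊆ Icc a b) :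
    IsC1Curve n P γ u v := by
  refine ⟨h.1.mono hs, fun s hs' ↦ ?_⟩
  rw [mfderivWithin_subset hs (uniqueMDiffWithinAt_Icc huv hs')
    ((h.1 s (hs hs')).mdifferentiableWithinAt one_ne_zero)]
  exact h.2 s (hs hs')

lemma IsC1Curve.joined (h : IsC1Curve n P γ a b) (huv : u < v) (hs : Icc u v ⊆ Icc a b) :
    C1Joined n P (γ u) (γ v) :=
  ⟨γ, u, v, huv, h.mono huv hs, rfl, rfl⟩

lemma IsC1Curve.comp_add (h : IsC1Curve n P γ a b) (hab : a < b) (r : ℝ) :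
    IsC1Curve n P (γ ∘ (· + r)) (a - r) (b - r) := by
  have hm : MapsTo (· + r) (Icc (a - r) (b - r)) (Icc a b) := fun s hs ↦
    ⟨by linarith [hs.1], by linarith [hs.2]⟩
  have hsm : ContMDiff 𝓘(ℝ, ℝ) 𝓘(ℝ, ℝ) 1 (· + r) :=
    (contDiff_id.add contDiff_const).contMDiff
  refine ⟨h.1.comp hsm.contMDiffOn hm, fun s hs ↦ ?_⟩
  have hab' : a - r < b - r := by linarith
  rw [mfderivWithin_comp s ((h.1 _ (hm hs)).mdifferentiableWithinAt one_ne_zero)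
    ((hsm s).mdifferentiableAt one_ne_zero).mdifferentiableWithinAt hm
    (uniqueMDiffWithinAt_Icc hab' hs)]
  have h1 : mfderivWithin 𝓘(ℝ, ℝ) 𝓘(ℝ, ℝ) (· + r) (Icc (a - r) (b - r)) s (1 : ℝ) = (1 : ℝ) := by
    rw [mfderivWithin_eq_fderivWithin, fderivWithin_add_const,
      fderivWithin_fun_id (uniqueDiffOn_Icc hab' s hs)]
    rfl
  have := h.2 _ (hm hs)
  rw [← h1] at this
  exact this

lemma IsC1Curve.isPiecewiseC1Curve (h : IsC1Curve n P γ a b) (hab : a < b) :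
    IsPiecewiseC1Curve n P γ a b := by
  -- The break points must increase strictly along all of `ℕ`, so they continue beyond `b`.
  refine ⟨hab, h.1.continuousOn, 1, fun i ↦ a + i * (b - a), ?_, by simp, by simp, ?_⟩
  · refine strictMono_nat_of_lt_succ fun i ↦ ?_
    push_cast
    linarith
  · intro i hi
    obtain rfl : i = 0 := by omega
    have : IsC1Curve n P γ (a + ((0 : ℕ) : ℝ) * (b - a)) (a + ((0 + 1 : ℕ) : ℝ) * (b - a)) := by
      simpa using h
    exact this

lemma IsPiecewiseC1Curve.append (h : IsPiecewiseC1Curve n P γ a b) (hq : C1Joined n P (γ b) q) :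
    ∃ (γ' : ℝ → M) (d : ℝ), b < d ∧ IsPiecewiseC1Curve n P γ' a d ∧ EqOn γ' γ (Icc a b) ∧
      γ' d = q := by
  obtain ⟨η, e, f, hef, hη, he, hf⟩ := hq
  obtain ⟨hab, hc, m, t, ht, t0, tm, hP⟩ := h
  have hbd : b < b + (f - e) := by linarith
  have hη' := hη.comp_add hef (e - b)
  rw [sub_sub_cancel, show f - (e - b) = b + (f - e) by ring] at hη'
  let γ' : ℝ → M := fun s ↦ if s ≤ b then γ s else η (s + (e - b))
  have h1 : EqOn γ' γ (Iic b) := fun s hs ↦ if_pos hs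
  have h2 : EqOn γ' (η ∘ (· + (e - b))) (Icc b (b + (f - e))) := by
    intro s hs
    rcases hs.1.eq_or_lt with rfl | h
    · simp [γ', he]
    · simp [γ', not_le.2 h]
  have hC := hη'.congr h2
  refine ⟨γ', b + (f - e), hbd, ⟨hab.trans hbd, ?_, m + 1,
    fun i ↦ if i ≤ m then t i else b + (i - m : ℝ) * (f - e), ?_, ?_, ?_, ?_⟩,
    h1.mono Icc_subset_Iic_self, ?_⟩
  · rw [← Icc_union_Icc_eq_Icc hab.le hbd.le]
    exact (hc.congr (h1.mono Icc_subset_Iic_self)).union_of_isClosed hC.1.continuousOn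
      isClosed_Icc isClosed_Icc
  · refine strictMono_nat_of_lt_succ fun i ↦ ?_
    rcases lt_trichotomy i m with h | rfl | h
    · rw [if_pos h.le, if_pos (by omega)]
      exact ht (Nat.lt_succ_self i)
    · rw [if_pos le_rfl, if_neg (by omega), tm]
      push_cast
      linarith
    · rw [if_neg (by omega), if_neg (by omega)]
      push_cast
      linarith
  · simpa using! t0
  · dsimp only
    rw [if_neg (by omega)]
    push_cast
    ring
  · intro i hi
    rcases (Nat.lt_succ_iff.1 hi).lt_or_eq with h | rfl
    · simp only [if_pos h.le, if_pos (show i + 1 ≤ m by omega)]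
      refine IsC1Curve.congr (hP i h) (h1.mono fun s hs ↦ hs.2.trans ?_)
      rw [← tm]
      exact ht.monotone h
    · simp only [if_pos le_rfl, if_neg (show ¬ i + 1 ≤ i by omega), tm]
      rw [show b + (((i + 1 : ℕ) : ℝ) - i) * (f - e) = b + (f - e) by push_cast; ring]
      exact hC
  · rw [h2 (right_mem_Icc.2 hbd.le), ← hf]
    simp only [Function.comp]
    congr 1
    ring

/-- Keeping `γ'` equal to `γ` on `[a, b]` preserves the parameter of the junction, where a curve
will be shown to have left `A`. -/
lemma IsPiecewiseC1Curve.append_transGen (h : IsPiecewiseC1Curve n P γ a b)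
    (hq : TransGen (C1Joined n P) (γ b) q) :
    ∃ (γ' : ℝ → M) (d : ℝ), b < d ∧ IsPiecewiseC1Curve n P γ' a d ∧ EqOn γ' γ (Icc a b) ∧
      γ' d = q := by
  induction hq with
  | single hq => exact h.append hq
  | tail _ hq ih =>
    obtain ⟨γ₁, d₁, h₁, h₂, h₃, h₄⟩ := ih
    rw [← h₄] at hq
    obtain ⟨γ₂, d₂, k₁, k₂, k₃, k₄⟩ := h₂.append hq
    exact ⟨γ₂, d₂, h₁.trans k₁, k₂,
      fun s hs ↦ (k₃ ⟨hs.1, hs.2.trans h₁.le⟩).trans (h₃ hs), k₄⟩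

lemma exists_isPiecewiseC1Curve (h : TransGen (C1Joined n P) p q) :
    ∃ (γ : ℝ → M) (a b : ℝ), IsPiecewiseC1Curve n P γ a b ∧ γ a = p ∧ γ b = q := by
  induction h with
  | single h =>
    obtain ⟨γ, a, b, hab, hγ, h1, h2⟩ := h
    exact ⟨γ, a, b, hγ.isPiecewiseC1Curve hab, h1, h2⟩
  | tail _ hq ih =>
    obtain ⟨γ, a, b, hγ, h1, h2⟩ := ih
    rw [← h2] at hq
    obtain ⟨γ', d, _, h3, h4, h5⟩ := hγ.append hq
    exact ⟨γ', a, d, h3, (h4 (left_mem_Icc.2 hγ.1.le)).trans h1, h5⟩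

lemma IsPiecewiseC1Curve.transGen (h : IsPiecewiseC1Curve n P γ a b) (hu : a ≤ u) (huv : u < v)
    (hv : v ≤ b) : TransGen (C1Joined n P) (γ u) (γ v) := by
  obtain ⟨-, -, m, t, ht, rfl, rfl, hP⟩ := h
  have key : ∀ j ≤ m, ∀ u v, t 0 ≤ u → u < v → v ≤ t j →
      TransGen (C1Joined n P) (γ u) (γ v) := by
    intro j
    induction j with
    | zero => intro _ u v h1 h2 h3; linarith
    | succ j ih =>
      intro hj u v h1 h2 h3
      have hC : IsC1Curve n P γ (t j) (t (j + 1)) := hP j hj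
      rcases le_or_gt v (t j) with h4 | h4
      · exact ih (by omega) u v h1 h2 h4
      rcases le_or_gt (t j) u with h5 | h5
      · exact .single (hC.joined h2 (Icc_subset_Icc h5 h3))
      · exact (ih (by omega) u (t j) h1 h5 le_rfl).tail
          (hC.joined h4 (Icc_subset_Icc le_rfl h3))
  exact key m le_rfl u v hu huv hv

/-- A curve that starts in an open set and leaves it has a first parameter outside of it. -/
lemma exists_first_exit {A : Set M} (hA : IsOpen A) (hc : ContinuousOn γ (Icc a b)) (hab : a ≤ b)
    (ha : γ a ∈ A) (hb : γ b ∉ A) : ∃ s ∈ Ioc a b, γ s ∈ closure A \ A := by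
  let S := Icc a b ∩ γ ⁻¹' Aᶜ
  have hS : IsClosed S := hc.preimage_isClosed_of_isClosed isClosed_Icc hA.isClosed_compl
  have hne : S.Nonempty := ⟨b, ⟨right_mem_Icc.2 hab, hb⟩⟩
  have hbd : BddBelow S := ⟨a, fun s hs ↦ hs.1.1⟩
  have hmem := hS.csInf_mem hne hbd
  set s := sInf S
  have has : a < s := lt_of_le_of_ne hmem.1.1 fun h ↦ hmem.2 (h ▸ ha)
  refine ⟨s, ⟨has, hmem.1.2⟩, ?_, hmem.2⟩
  have h1 : s ∈ closure (Ico a s) := by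
    rw [closure_Ico has.ne]
    exact right_mem_Icc.2 has.le
  refine ((hc s hmem.1).mono (Ico_subset_Icc_self.trans (Icc_subset_Icc le_rfl hmem.1.2))).mem_closure
    h1 fun r hr ↦ ?_
  by_contra h
  exact not_lt.2 (csInf_le hbd (show r ∈ S from ⟨⟨hr.1, hr.2.le.trans hmem.1.2⟩, h⟩)) hr.2

end Curves

variable {n : ℕ} {k : ℕ∞} {M : Type*} [TopologicalSpace M]
  [ChartedSpace (EuclideanSpace ℝ (Fin n)) M] [IsManifold (𝓡 n) ∞ M]
  {X : SpacetimeStructure n k M} {p q r : M}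

/-- Transitivity becomes formal, and local arguments need only treat a single `C^1` piece. -/
lemma chron_iff_transGen : X.Chron p q ↔ TransGen (C1Joined n X.FutureTimelike) p q := by
  refine ⟨?_, exists_isPiecewiseC1Curve⟩
  rintro ⟨γ, a, b, h, rfl, rfl⟩
  exact IsPiecewiseC1Curve.transGen h le_rfl h.1 le_rfl

lemma Chron.trans (h : X.Chron p q) (h' : X.Chron q r) : X.Chron p r :=
  chron_iff_transGen.2 ((chron_iff_transGen.1 h).trans (chron_iff_transGen.1 h'))

lemma C1Joined.chron (h : C1Joined n X.FutureTimelike p q) : X.Chron p q :=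
  chron_iff_transGen.2 (.single h)

lemma FutureTimelike.futureCausal {x : M} {v : TangentSpace (𝓡 n) x}
    (h : X.FutureTimelike x v) : X.FutureCausal x v :=
  ⟨fun h0 ↦ by simpa [h0] using h.1, h.1.le, h.2⟩

end

/-! ### First-order perturbation of curves in a chart -/

section

/-- Strict differentiability makes the error `o(ε)` uniform in the base point `z.1`, which will run
along a curve. -/
lemma _root_.HasStrictFDerivAt.eventually_neg {V : Type*} [NormedAddCommGroup V] [NormedSpace ℝ V]
    {Q : V → ℝ} {Q' : V →L[ℝ] ℝ} {p₀ d₀ : V} (h : HasStrictFDerivAt Q Q' p₀) (hd : Q' d₀ < 0) :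
    ∀ᶠ z : V × V × ℝ in 𝓝 (p₀, d₀, 0), 0 < z.2.2 → Q z.1 ≤ 0 → Q (z.1 + z.2.2 • z.2.1) < 0 := by
  have hn : 0 < ‖d₀‖ + 1 := by positivity
  -- With `‖d‖ < ‖d₀‖ + 1` the error is at most `ε (-Q' d₀ / 2)`, which is beaten by `Q' d < Q' d₀ /
  -- 2`.
  have hκ : 0 < -Q' d₀ / 2 / (‖d₀‖ + 1) := by
    apply div_pos _ hn
    linarith
  have ht : Tendsto (fun z : V × V × ℝ ↦ (z.1 + z.2.2 • z.2.1, z.1)) (𝓝 (p₀, d₀, 0))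
      (𝓝 (p₀, p₀)) := by
    have : Continuous (fun z : V × V × ℝ ↦ (z.1 + z.2.2 • z.2.1, z.1)) := by fun_prop
    simpa using this.tendsto (p₀, d₀, 0)
  have h1 := ht.eventually (h.isLittleO.def hκ)
  have h2 : ∀ᶠ z : V × V × ℝ in 𝓝 (p₀, d₀, 0), Q' z.2.1 < Q' d₀ / 2 := by
    have : Continuous (fun z : V × V × ℝ ↦ Q' z.2.1) := by fun_prop
    exact this.continuousAt.eventually_lt continuousAt_const (by dsimp only; linarith)
  have h3 : ∀ᶠ z : V × V × ℝ in 𝓝 (p₀, d₀, 0), ‖z.2.1‖ < ‖d₀‖ + 1 := by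
    have : Continuous (fun z : V × V × ℝ ↦ ‖z.2.1‖) := by fun_prop
    exact this.continuousAt.eventually_lt continuousAt_const (by dsimp only; linarith)
  filter_upwards [h1, h2, h3] with z h1 h2 h3 hz hQ
  obtain ⟨p, d, ε⟩ := z
  simp only [add_sub_cancel_left, map_smul, smul_eq_mul, norm_smul, Real.norm_eq_abs,
    abs_of_pos hz] at h1 h2 h3 hz hQ ⊢
  have h4 := (le_abs_self _).trans h1
  have h5 : -Q' d₀ / 2 / (‖d₀‖ + 1) * (ε * ‖d‖) ≤ ε * (-Q' d₀ / 2) := by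
    calc _ ≤ -Q' d₀ / 2 / (‖d₀‖ + 1) * (ε * (‖d₀‖ + 1)) := by gcongr
      _ = _ := by field_simp
  have h6 := mul_lt_mul_of_pos_left h2 hz
  linarith

variable {n : ℕ} {k : ℕ∞} {M : Type*} [TopologicalSpace M]
  [ChartedSpace (EuclideanSpace ℝ (Fin n)) M] [IsManifold (𝓡 n) ∞ M]

section Chart

variable {P : ∀ x : M, TangentSpace (𝓡 n) x → Prop} {γ : ℝ → M} {a b u v s₀ : ℝ} {x₀ : M}
  {c : ℝ → EuclideanSpace ℝ (Fin n)}

lemma contMDiffOn_symm_comp (hc : ContDiffOn ℝ 1 c (Icc a b))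
    (ht : ∀ s ∈ Icc a b, c s ∈ (extChartAt (𝓡 n) x₀).target) :
    ContMDiffOn 𝓘(ℝ, ℝ) (𝓡 n) 1 ((extChartAt (𝓡 n) x₀).symm ∘ c) (Icc a b) := by
  have : IsManifold (𝓡 n) 1 M := IsManifold.of_le (n := ∞) (by simp)
  exact (contMDiffOn_extChartAt_symm x₀).comp hc.contMDiffOn ht

lemma mfderivWithin_symm_comp (hab : a < b) (hc : ContDiffOn ℝ 1 c (Icc a b))
    (ht : ∀ s ∈ Icc a b, c s ∈ (extChartAt (𝓡 n) x₀).target) {s : ℝ} (hs : s ∈ Icc a b) :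
    mfderivWithin 𝓘(ℝ, ℝ) (𝓡 n) ((extChartAt (𝓡 n) x₀).symm ∘ c) (Icc a b) s (1 : ℝ) =
      chartVec x₀ (c s) (derivWithin c (Icc a b) s) := by
  have : IsManifold (𝓡 n) 1 M := IsManifold.of_le (n := ∞) (by simp)
  have h1 : MDifferentiableAt 𝓘(ℝ, EuclideanSpace ℝ (Fin n)) (𝓡 n) (extChartAt (𝓡 n) x₀).symm
      (c s) :=
    ((contMDiffOn_extChartAt_symm (n := 1) x₀).contMDiffAt
      ((isOpen_extChartAt_target x₀).mem_nhds (ht s hs))).mdifferentiableAt one_ne_zero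
  rw [mfderiv_comp_mfderivWithin s h1
    ((hc s hs).contMDiffWithinAt.mdifferentiableWithinAt one_ne_zero)
    (uniqueMDiffWithinAt_Icc hab hs), chartVec_eq_mfderiv x₀ (ht s hs),
    mfderivWithin_eq_fderivWithin]
  rfl

lemma isC1Curve_symm_comp (hab : a < b) (hc : ContDiffOn ℝ 1 c (Icc a b))
    (ht : ∀ s ∈ Icc a b, c s ∈ (extChartAt (𝓡 n) x₀).target) :
    IsC1Curve n P ((extChartAt (𝓡 n) x₀).symm ∘ c) a b ↔
      ∀ s ∈ Icc a b, InChart P x₀ (c s) (derivWithin c (Icc a b) s) := by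
  constructor
  · intro h s hs
    have := h.2 s hs
    rwa [mfderivWithin_symm_comp hab hc ht hs] at this
  · refine fun h ↦ ⟨contMDiffOn_symm_comp hc ht, fun s hs ↦ ?_⟩
    rw [mfderivWithin_symm_comp hab hc ht hs]
    exact h s hs

/-- Near each of its parameters, a `C^1` curve can be read in a chart. -/
lemma IsC1Curve.exists_chart (h : IsC1Curve n P γ a b) (hab : a < b) (hs₀ : s₀ ∈ Icc a b) :
    ∃ (a' b' : ℝ) (c : ℝ → EuclideanSpace ℝ (Fin n)), a' < b' ∧ Icc a' b' ⊆ Icc a b ∧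
      s₀ ∈ Icc a' b' ∧ Icc a' b' ∈ 𝓝[Icc a b] s₀ ∧ ContDiffOn ℝ 1 c (Icc a' b') ∧
      c s₀ = extChartAt (𝓡 n) (γ s₀) (γ s₀) ∧
      ∀ s ∈ Icc a' b', c s ∈ (extChartAt (𝓡 n) (γ s₀)).target ∧
        (extChartAt (𝓡 n) (γ s₀)).symm (c s) = γ s ∧
        InChart P (γ s₀) (c s) (derivWithin c (Icc a' b') s) := by
  have : IsManifold (𝓡 n) 1 M := IsManifold.of_le (n := ∞) (by simp)
  obtain ⟨ε, hε, hsub⟩ := Metric.mem_nhdsWithin_iff.1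
    ((h.1.continuousOn s₀ hs₀) (extChartAt_source_mem_nhds (I := 𝓡 n) (γ s₀)))
  have hlt : max a (s₀ - ε / 2) < min b (s₀ + ε / 2) := by
    obtain ⟨h1, h2⟩ := hs₀
    apply max_lt <;> apply lt_min <;> linarith
  have hIcc : Icc (max a (s₀ - ε / 2)) (min b (s₀ + ε / 2)) ⊆ Icc a b :=
    Icc_subset_Icc (le_max_left _ _) (min_le_left _ _)
  have hmem : ∀ s ∈ Icc (max a (s₀ - ε / 2)) (min b (s₀ + ε / 2)),
      γ s ∈ (extChartAt (𝓡 n) (γ s₀)).source := by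
    intro s hs
    refine hsub ⟨?_, hIcc hs⟩
    have h1 := (le_max_right _ _).trans hs.1
    have h2 := hs.2.trans (min_le_right _ _)
    rw [Metric.mem_ball, Real.dist_eq, abs_lt]
    constructor <;> linarith
  have hc : ContDiffOn ℝ 1 (extChartAt (𝓡 n) (γ s₀) ∘ γ)
      (Icc (max a (s₀ - ε / 2)) (min b (s₀ + ε / 2))) := by
    rw [← contMDiffOn_iff_contDiffOn]
    refine (contMDiffOn_extChartAt (I := 𝓡 n) (n := 1) (x := γ s₀)).comp (h.1.mono hIcc) ?_
    intro s hs
    simpa using hmem s hs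
  have ht : ∀ s ∈ Icc (max a (s₀ - ε / 2)) (min b (s₀ + ε / 2)),
      (extChartAt (𝓡 n) (γ s₀) ∘ γ) s ∈ (extChartAt (𝓡 n) (γ s₀)).target :=
    fun s hs ↦ (extChartAt (𝓡 n) (γ s₀)).map_source (hmem s hs)
  have hinv : ∀ s ∈ Icc (max a (s₀ - ε / 2)) (min b (s₀ + ε / 2)),
      (extChartAt (𝓡 n) (γ s₀)).symm ((extChartAt (𝓡 n) (γ s₀) ∘ γ) s) = γ s :=
    fun s hs ↦ (extChartAt (𝓡 n) (γ s₀)).left_inv (hmem s hs)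
  have hcurve := (isC1Curve_symm_comp hlt hc ht).1 ((h.mono hlt hIcc).congr hinv)
  refine ⟨_, _, _, hlt, hIcc, ⟨?_, ?_⟩, ?_, hc, rfl, fun s hs ↦ ⟨ht s hs, hinv s hs, hcurve s hs⟩⟩
  · exact max_le hs₀.1 (by linarith)
  · exact le_min hs₀.2 (by linarith)
  · refine Metric.mem_nhdsWithin_iff.2 ⟨ε / 2, by positivity, fun s hs ↦ ?_⟩
    have h1 := hs.1
    rw [Metric.mem_ball, Real.dist_eq, abs_lt] at h1
    exact ⟨max_le hs.2.1 (by linarith), le_min hs.2.2 (by linarith)⟩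

/-- Affine displacements serve both purposes: moving end points of timelike curves and pushing
causal curves. The derivative stays relative to `[a, b]`, so one continuity estimate there covers
all subintervals. -/
lemma c1Joined_of_affine_perturbation (hc : ContDiffOn ℝ 1 c (Icc a b)) (hau : a ≤ u) (huv : u < v)
    (hvb : v ≤ b) (z d : EuclideanSpace ℝ (Fin n))
    (h : ∀ s ∈ Icc u v, c s + (z + s • d) ∈ (extChartAt (𝓡 n) x₀).target ∧
      InChart P x₀ (c s + (z + s • d)) (derivWithin c (Icc a b) s + d)) :
    C1Joined n P ((extChartAt (𝓡 n) x₀).symm (c u + (z + u • d)))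
      ((extChartAt (𝓡 n) x₀).symm (c v + (z + v • d))) := by
  have hsub : Icc u v ⊆ Icc a b := Icc_subset_Icc hau hvb
  have hc' : ContDiffOn ℝ 1 (fun s ↦ c s + (z + s • d)) (Icc u v) :=
    (hc.mono hsub).add (by fun_prop)
  refine ⟨(extChartAt (𝓡 n) x₀).symm ∘ (fun s ↦ c s + (z + s • d)), u, v, huv,
    (isC1Curve_symm_comp huv hc' fun s hs ↦ (h s hs).1).2 fun s hs ↦ ?_, rfl, rfl⟩
  have h1 : HasDerivWithinAt (fun s ↦ c s + (z + s • d)) (derivWithin c (Icc a b) s + d)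
      (Icc u v) s := by
    refine (((hc s (hsub hs)).differentiableWithinAt one_ne_zero).hasDerivWithinAt.mono hsub).add ?_
    simpa using! (((hasDerivAt_id s).smul_const d).const_add z).hasDerivWithinAt
  rw [h1.derivWithin (uniqueDiffOn_Icc huv s hs)]
  exact (h s hs).2

lemma tendsto_curve_deriv (hc : ContDiffOn ℝ 1 c (Icc a b)) (hab : a < b) (hs₀ : s₀ ∈ Icc a b) :
    Tendsto (fun s ↦ (c s, derivWithin c (Icc a b) s)) (𝓝[Icc a b] s₀)
      (𝓝 (c s₀, derivWithin c (Icc a b) s₀)) :=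
  (hc.continuousOn s₀ hs₀).prodMk_nhds
    ((hc.continuousOn_derivWithin (uniqueDiffOn_Icc hab) le_rfl) s₀ hs₀)

end Chart

section Cone

variable (X : SpacetimeStructure n k M) (x₀ : M)

lemma isOpen_chartTime_neg :
    IsOpen {p : EuclideanSpace ℝ (Fin n) × EuclideanSpace ℝ (Fin n) |
      p.1 ∈ (extChartAt (𝓡 n) x₀).target ∧ X.chartTime x₀ p < 0} := by
  convert (X.continuousOn_chartTime x₀).isOpen_inter_preimage (isOpen_target_prod x₀)
    isOpen_Iio (t := Iio 0) using 1
  ext p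
  simp

lemma isOpen_futureTimelike_inChart (hk : 1 ≤ k) :
    IsOpen {p : EuclideanSpace ℝ (Fin n) × EuclideanSpace ℝ (Fin n) |
      p.1 ∈ (extChartAt (𝓡 n) x₀).target ∧ InChart X.FutureTimelike x₀ p.1 p.2} := by
  have he : {p : EuclideanSpace ℝ (Fin n) × EuclideanSpace ℝ (Fin n) |
      p.1 ∈ (extChartAt (𝓡 n) x₀).target ∧ InChart X.FutureTimelike x₀ p.1 p.2} =
      (((extChartAt (𝓡 n) x₀).target ×ˢ univ) ∩ X.chartQuad x₀ ⁻¹' Iio 0) ∩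
        {p | p.1 ∈ (extChartAt (𝓡 n) x₀).target ∧ X.chartTime x₀ p < 0} := by
    ext p
    exact ⟨fun h ↦ ⟨⟨⟨h.1, mem_univ _⟩, h.2.1⟩, h.1, h.2.2⟩, fun h ↦ ⟨h.2.1, h.1.2, h.2.2⟩⟩
  rw [he]
  exact ((X.contDiffOn_chartQuad hk x₀).continuousOn.isOpen_inter_preimage
    (isOpen_target_prod x₀) isOpen_Iio).inter (X.isOpen_chartTime_neg x₀)

lemma chartVec_add_smul (y w τ : EuclideanSpace ℝ (Fin n)) (t : ℝ) :
    chartVec x₀ y (w + t • τ) = chartVec x₀ y w + t • chartVec x₀ y τ := by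
  simp only [chartVec, map_add, map_smul]

variable {X x₀}

/-- Along `(0, τ)` the function is the polynomial `g(w, w) + 2 t g(T, w) + t² g(T, T)`, whose linear
coefficient is the derivative. -/
lemma fderiv_chartQuad (hk : 1 ≤ k) {y w τ : EuclideanSpace ℝ (Fin n)}
    (hy : y ∈ (extChartAt (𝓡 n) x₀).target) (hτ : chartVec x₀ y τ = X.T _) :
    HasStrictFDerivAt (X.chartQuad x₀) (fderiv ℝ (X.chartQuad x₀) (y, w)) (y, w) ∧
      fderiv ℝ (X.chartQuad x₀) (y, w) (0, τ) = 2 * X.chartTime x₀ (y, w) := by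
  have h1 : ContDiffAt ℝ 1 (X.chartQuad x₀) (y, w) :=
    (X.contDiffOn_chartQuad hk x₀).contDiffAt ((isOpen_target_prod x₀).mem_nhds ⟨hy, mem_univ _⟩)
  have h2 := h1.hasStrictFDerivAt one_ne_zero
  refine ⟨h2, ?_⟩
  have h3 : HasDerivAt (fun t : ℝ ↦ ((y, w) : EuclideanSpace ℝ (Fin n) × EuclideanSpace ℝ (Fin n))
      + t • (0, τ)) (0, τ) 0 := by
    simpa using! ((hasDerivAt_id (0 : ℝ)).smul_const
      ((0, τ) : EuclideanSpace ℝ (Fin n) × EuclideanSpace ℝ (Fin n))).const_add (y, w)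
  have h4 := HasFDerivAt.comp_hasDerivAt (0 : ℝ)
    (f := fun t : ℝ ↦ ((y, w) : EuclideanSpace ℝ (Fin n) × EuclideanSpace ℝ (Fin n)) + t • (0, τ))
    (l := X.chartQuad x₀) (l' := fderiv ℝ (X.chartQuad x₀) (y, w))
    (by simpa using! h2.hasFDerivAt) h3
  have h5 : (X.chartQuad x₀ ∘ fun t : ℝ ↦
      ((y, w) : EuclideanSpace ℝ (Fin n) × EuclideanSpace ℝ (Fin n)) + t • (0, τ)) =
      fun t ↦ X.chartQuad x₀ (y, w) + t * (2 * X.chartTime x₀ (y, w)) +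
        t ^ 2 * X.chartQuad x₀ (y, τ) := by
    ext t
    have h6 : ((y, w) : EuclideanSpace ℝ (Fin n) × EuclideanSpace ℝ (Fin n)) + t • (0, τ) =
        (y, w + t • τ) := by simp
    rw [Function.comp_apply, h6]
    simp only [chartQuad, chartTime, chartVec_add_smul, map_add, map_smul, add_apply, smul_apply,
      smul_eq_mul, hτ, X.g.symm _ (chartVec x₀ y w) (X.T _)]
    ring
  rw [h5] at h4
  refine h4.unique ?_
  have := (((hasDerivAt_id (0 : ℝ)).mul_const (2 * X.chartTime x₀ (y, w))).const_add
    (X.chartQuad x₀ (y, w))).add (((hasDerivAt_id (0 : ℝ)).pow 2).mul_const (X.chartQuad x₀ (y, τ)))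
  simpa using! this

end Cone

end

section

variable {n : ℕ} {k : ℕ∞} {M : Type*} [TopologicalSpace M]
  [ChartedSpace (EuclideanSpace ℝ (Fin n)) M] [IsManifold (𝓡 n) ∞ M]
  {X : SpacetimeStructure n k M}

/-! ### Local deformations of timelike and causal curves -/

section Local

variable {γ : ℝ → M} {a b u v s₀ : ℝ} {x₀ : M} {c : ℝ → EuclideanSpace ℝ (Fin n)}

/-- The displacement interpolates affinely between `z₁` at `u` and `z₂` at `v`. Its slope is `(z₂ -
z₁) / (v - u)`, so `r` depends on `u` and `v` while `δ` does not. -/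
lemma exists_c1Joined_chart_perturbation (hk : 1 ≤ k) (hc : ContDiffOn ℝ 1 c (Icc a b))
    (hab : a < b) (hs₀ : s₀ ∈ Icc a b) (ht : c s₀ ∈ (extChartAt (𝓡 n) x₀).target)
    (hP : InChart X.FutureTimelike x₀ (c s₀) (derivWithin c (Icc a b) s₀)) :
    ∃ δ > 0, ∀ u v, a ≤ u → u < v → v ≤ b → |u - s₀| < δ → |v - s₀| < δ → ∃ r > 0,
      ∀ z₁ z₂ : EuclideanSpace ℝ (Fin n), ‖z₁‖ < r → ‖z₂‖ < r →
        C1Joined n X.FutureTimelike ((extChartAt (𝓡 n) x₀).symm (c u + z₁))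
          ((extChartAt (𝓡 n) x₀).symm (c v + z₂)) := by
  obtain ⟨ρ, hρ, hball⟩ := Metric.isOpen_iff.1 (X.isOpen_futureTimelike_inChart x₀ hk)
    (c s₀, derivWithin c (Icc a b) s₀) ⟨ht, hP⟩
  obtain ⟨δ, hδ, hsub⟩ := Metric.mem_nhdsWithin_iff.1
    ((tendsto_curve_deriv hc hab hs₀) (Metric.ball_mem_nhds _ (half_pos hρ)))
  refine ⟨δ, hδ, fun u v hau huv hvb hu hv ↦ ?_⟩
  have hL : 0 < v - u := sub_pos.2 huv
  -- The displacement is at most `‖z₁‖ + ‖z₂ - z₁‖ < 3 ρ / 6`, and the slope is less than `ρ / 2`.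
  refine ⟨min (ρ / 6) (ρ * (v - u) / 4), by positivity, fun z₁ z₂ hz₁ hz₂ ↦ ?_⟩
  have hz₁' := hz₁.trans_le (min_le_left _ _)
  have hz₂' := hz₂.trans_le (min_le_left _ _)
  have hz₁'' := hz₁.trans_le (min_le_right _ _)
  have hz₂'' := hz₂.trans_le (min_le_right _ _)
  have hd : ‖(v - u)⁻¹ • (z₂ - z₁)‖ < ρ / 2 := by
    rw [norm_smul, norm_inv, Real.norm_of_nonneg hL.le, inv_mul_lt_iff₀ hL]
    linarith [norm_sub_le z₂ z₁]
  set d := (v - u)⁻¹ • (z₂ - z₁) with hd_def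
  have hvd : (v - u) • d = z₂ - z₁ := smul_inv_smul₀ hL.ne' _
  clear_value d
  have key := c1Joined_of_affine_perturbation (P := X.FutureTimelike) (x₀ := x₀) hc hau huv hvb
    (z₁ - u • d) d ?_
  · rw [sub_add_cancel, show z₁ - u • d + v • d = z₂ by
      rw [sub_add_eq_add_sub, add_sub_assoc, ← sub_smul, hvd]; abel] at key
    exact key
  · intro s hs
    have h1 : dist (c s, derivWithin c (Icc a b) s) (c s₀, derivWithin c (Icc a b) s₀) < ρ / 2 := by
      refine hsub ⟨?_, hau.trans hs.1, hs.2.trans hvb⟩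
      rw [abs_lt] at hu hv
      rw [Metric.mem_ball, Real.dist_eq, abs_lt]
      constructor <;> linarith [hs.1, hs.2]
    have h2 : ‖z₁ - u • d + s • d‖ < ρ / 2 := by
      rw [sub_add_eq_add_sub, add_sub_assoc, ← sub_smul]
      have h3 : ‖(s - u) • d‖ ≤ ‖z₂ - z₁‖ := by
        rw [← hvd, norm_smul, norm_smul, Real.norm_of_nonneg (sub_nonneg.2 hs.1),
          Real.norm_of_nonneg hL.le]
        exact mul_le_mul_of_nonneg_right (by linarith [hs.2]) (norm_nonneg _)
      linarith [norm_add_le z₁ ((s - u) • d), norm_sub_le z₂ z₁]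
    refine @hball (c s + (z₁ - u • d + s • d), derivWithin c (Icc a b) s + d) ?_
    rw [Metric.mem_ball]
    refine (dist_triangle _ (c s, derivWithin c (Icc a b) s) _).trans_lt ?_
    have h4 : dist (c s + (z₁ - u • d + s • d), derivWithin c (Icc a b) s + d)
        (c s, derivWithin c (Icc a b) s) < ρ / 2 := by
      rw [Prod.dist_eq, max_lt_iff]
      simpa only [dist_self_add_left] using ⟨h2, hd⟩
    linarith

/-- Pushing a causal curve along a timelike direction, by an amount that increases with the
parameter, makes it timelike. -/
lemma exists_c1Joined_chart_push (hk : 1 ≤ k) (hc : ContDiffOn ℝ 1 c (Icc a b)) (hab : a < b)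
    (hs₀ : s₀ ∈ Icc a b) (ht : c s₀ ∈ (extChartAt (𝓡 n) x₀).target)
    (hP : ∀ s ∈ Icc a b, InChart X.FutureCausal x₀ (c s) (derivWithin c (Icc a b) s)) :
    ∃ (τ : EuclideanSpace ℝ (Fin n)) (δ : ℝ), 0 < δ ∧ ∀ u v r ε, a ≤ u → u < v → v ≤ b →
      |u - s₀| < δ → |v - s₀| < δ → |r - s₀| < δ → 0 < ε → ε < δ →
        C1Joined n X.FutureTimelike ((extChartAt (𝓡 n) x₀).symm (c u + (ε * (u - r)) • τ))
          ((extChartAt (𝓡 n) x₀).symm (c v + (ε * (v - r)) • τ)) := by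
  obtain ⟨τ, hτ⟩ := exists_chartVec_eq x₀ ht (X.T _)
  obtain ⟨hstrict, hderiv⟩ := fderiv_chartQuad hk (w := derivWithin c (Icc a b) s₀) ht hτ
  have hL : X.chartTime x₀ (c s₀, derivWithin c (Icc a b) s₀) < 0 := (hP s₀ hs₀).2.2
  -- Position and velocity change by `ε • ((s - r) • τ, τ)`, a direction close to `(0, τ)` for `s`
  -- near `r`.
  have h1 := hstrict.eventually_neg (d₀ := (0, τ)) (by rw [hderiv]; linarith)
  have hΩ := (X.isOpen_chartTime_neg x₀).mem_nhds
    (show (c s₀, derivWithin c (Icc a b) s₀) ∈ _ from ⟨ht, hL⟩)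
  have hcont : Continuous (fun z : (EuclideanSpace ℝ (Fin n) × EuclideanSpace ℝ (Fin n)) × ℝ × ℝ ↦
      (z.1, ((z.2.1 • τ, τ) : EuclideanSpace ℝ (Fin n) × EuclideanSpace ℝ (Fin n)), z.2.2)) := by
    fun_prop
  have hcont' : Continuous (fun z : (EuclideanSpace ℝ (Fin n) × EuclideanSpace ℝ (Fin n)) × ℝ × ℝ ↦
      z.1 + z.2.2 • ((z.2.1 • τ, τ) : EuclideanSpace ℝ (Fin n) × EuclideanSpace ℝ (Fin n))) := by
    fun_prop
  have ht1 := hcont.tendsto ((c s₀, derivWithin c (Icc a b) s₀), 0, 0)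
  have ht2 := hcont'.tendsto ((c s₀, derivWithin c (Icc a b) s₀), 0, 0)
  simp only [zero_smul, add_zero] at ht1 ht2
  obtain ⟨ρ, hρ, hball⟩ := Metric.eventually_nhds_iff.1 ((ht1.eventually h1).and (ht2 hΩ))
  obtain ⟨δ, hδ, hsub⟩ := Metric.mem_nhdsWithin_iff.1
    ((tendsto_curve_deriv hc hab hs₀) (Metric.ball_mem_nhds _ hρ))
  refine ⟨τ, min δ (ρ / 2), by positivity, fun u v r ε hau huv hvb hu hv hr hε hε' ↦ ?_⟩
  -- The displacement is `ε (s - r) τ`, so `r` is the parameter at which the curve stays fixed.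
  have key := c1Joined_of_affine_perturbation (P := X.FutureTimelike) (x₀ := x₀) hc hau huv hvb
    (-(ε * r) • τ) (ε • τ) ?_
  · have he : ∀ s : ℝ, -(ε * r) • τ + s • ε • τ = (ε * (s - r)) • τ := fun s ↦ by module
    rwa [he, he] at key
  · intro s hs
    have hs' : s ∈ Icc a b := ⟨hau.trans hs.1, hs.2.trans hvb⟩
    have hss : |s - s₀| < min δ (ρ / 2) := by
      rw [abs_lt] at hu hv ⊢
      constructor <;> linarith [hs.1, hs.2]
    have h2 : dist (c s, derivWithin c (Icc a b) s) (c s₀, derivWithin c (Icc a b) s₀) < ρ := by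
      refine hsub ⟨?_, hs'⟩
      rw [Metric.mem_ball, Real.dist_eq]
      exact hss.trans_le (min_le_left _ _)
    have h3 : |s - r| < ρ := by
      have h4 := hss.trans_le (min_le_right _ _)
      have h5 := hr.trans_le (min_le_right _ _)
      rw [abs_lt] at h4 h5 ⊢
      constructor <;> linarith
    have h6 : |ε| < ρ := by
      rw [abs_of_pos hε]
      linarith [hε'.trans_le (min_le_right _ _)]
    obtain ⟨h7, h8⟩ := @hball ((c s, derivWithin c (Icc a b) s), s - r, ε) (by
      rw [Prod.dist_eq, Prod.dist_eq]
      exact max_lt h2 (max_lt (by simpa [Real.dist_eq] using h3) (by simpa [Real.dist_eq] using h6)))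
    have h9 := h7 hε (hP s hs').2.1
    have he : -(ε * r) • τ + s • ε • τ = ε • (s - r) • τ := by module
    rw [he]
    exact ⟨h8.1, h9, h8.2⟩

end Local

/-! ### Openness of chronological futures and pasts, and push-up -/

variable {p q x y : M} {γ : ℝ → M} {a b s₀ : ℝ}

/-- `I⁺(p)` is open. -/
lemma Chron.mem_nhds_right (hk : 1 ≤ k) (h : X.Chron p y) : {z | X.Chron p z} ∈ 𝓝 y := by
  -- It suffices to move the end point of the last `C^1` piece.
  have key : ∀ r, C1Joined n X.FutureTimelike r y →
      {z | TransGen (C1Joined n X.FutureTimelike) r z} ∈ 𝓝 y := by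
    rintro r ⟨γ, a, b, hab, hγ, rfl, rfl⟩
    obtain ⟨a', b', c, hab', hsub, hs, -, hc, hcs, hP⟩ :=
      hγ.exists_chart hab (right_mem_Icc.2 hab.le)
    obtain ⟨δ, hδ, H⟩ := exists_c1Joined_chart_perturbation hk hc hab' hs (hP b hs).1 (hP b hs).2.2
    have hb' : b' = b := le_antisymm (hsub (right_mem_Icc.2 hab'.le)).2 hs.2
    have ha' : a ≤ a' := (hsub (left_mem_Icc.2 hab'.le)).1
    subst hb'
    obtain ⟨u, hu1, hu2⟩ := exists_between (max_lt hab' (show b' - δ < b' by linarith))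
    rw [max_lt_iff] at hu1
    obtain ⟨ρ, hρ, H'⟩ := H u b' hu1.1.le hu2 le_rfl (by rw [abs_lt]; constructor <;> linarith)
      (by simpa)
    have hu : u ∈ Icc a' b' := ⟨hu1.1.le, hu2.le⟩
    filter_upwards [extChartAt_source_mem_nhds (I := 𝓡 n) (γ b'),
      (continuousAt_extChartAt (I := 𝓡 n) (γ b')) (Metric.ball_mem_nhds _ hρ)] with z hz hz'
    have h1 := H' 0 (extChartAt (𝓡 n) (γ b') z - c b') (by simpa) (by
      rw [hcs]; simpa [dist_eq_norm] using hz')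
    rw [add_zero, (hP u hu).2.1, add_sub_cancel, (extChartAt (𝓡 n) (γ b')).left_inv hz] at h1
    exact .tail (.single (hγ.joined (ha'.trans_lt hu1.1) (Icc_subset_Icc le_rfl hu2.le))) h1
  simp only [chron_iff_transGen] at h ⊢
  cases h with
  | single h => exact key _ h
  | tail h' h => exact mem_of_superset (key _ h) fun z hz ↦ h'.trans hz

/-- `I⁻(q)` is open. -/
lemma Chron.mem_nhds_left (hk : 1 ≤ k) (h : X.Chron y q) : {z | X.Chron z q} ∈ 𝓝 y := by
  have key : ∀ r, C1Joined n X.FutureTimelike y r →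
      {z | TransGen (C1Joined n X.FutureTimelike) z r} ∈ 𝓝 y := by
    rintro r ⟨γ, a, b, hab, hγ, rfl, rfl⟩
    obtain ⟨a', b', c, hab', hsub, hs, -, hc, hcs, hP⟩ :=
      hγ.exists_chart hab (left_mem_Icc.2 hab.le)
    obtain ⟨δ, hδ, H⟩ := exists_c1Joined_chart_perturbation hk hc hab' hs (hP a hs).1 (hP a hs).2.2
    have ha' : a' = a := le_antisymm hs.1 (hsub (left_mem_Icc.2 hab'.le)).1
    have hb' : b' ≤ b := (hsub (right_mem_Icc.2 hab'.le)).2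
    subst ha'
    obtain ⟨u, hu1, hu2⟩ := exists_between (lt_min hab' (show a' < a' + δ by linarith))
    rw [lt_min_iff] at hu2
    obtain ⟨ρ, hρ, H'⟩ := H a' u le_rfl hu1 hu2.1.le (by simpa)
      (by rw [abs_lt]; constructor <;> linarith)
    have hu : u ∈ Icc a' b' := ⟨hu1.le, hu2.1.le⟩
    filter_upwards [extChartAt_source_mem_nhds (I := 𝓡 n) (γ a'),
      (continuousAt_extChartAt (I := 𝓡 n) (γ a')) (Metric.ball_mem_nhds _ hρ)] with z hz hz'
    have h1 := H' (extChartAt (𝓡 n) (γ a') z - c a') 0 (by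
      rw [hcs]; simpa [dist_eq_norm] using hz') (by simpa)
    rw [add_zero, (hP u hu).2.1, add_sub_cancel, (extChartAt (𝓡 n) (γ a')).left_inv hz] at h1
    exact .head h1 (.single (hγ.joined (hu2.1.trans_le hb') (Icc_subset_Icc hu1.le le_rfl)))
  simp only [chron_iff_transGen] at h ⊢
  rw [TransGen.head'_iff] at h
  obtain ⟨r, h1, h2⟩ := h
  exact mem_of_superset (key _ h1) fun z hz ↦ hz.trans_left h2

/-- Fix one end of the arc and push the other along `τ`. The pushed end tends to the original one as
`ε → 0`, so it enters the open set `I⁺(p)` (fixing `γ v`) or `I⁻(q)` (fixing `γ u`). -/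
lemma exists_local_push_up (hk : 1 ≤ k) (h : IsC1Curve n X.FutureCausal γ a b) (hab : a < b)
    (hs₀ : s₀ ∈ Icc a b) :
    ∃ δ > 0, ∀ u ∈ Icc a b, ∀ v ∈ Icc a b, u < v → |u - s₀| < δ → |v - s₀| < δ →
      (∀ p, X.Chron p (γ u) → X.Chron p (γ v)) ∧ ∀ q, X.Chron (γ v) q → X.Chron (γ u) q := by
  obtain ⟨a', b', c, hab', hsub, hs, hnhds, hc, hcs, hP⟩ := h.exists_chart hab hs₀
  obtain ⟨τ, δ, hδ, H⟩ := exists_c1Joined_chart_push hk hc hab' hs (hP s₀ hs).1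
    fun s hs ↦ (hP s hs).2.2
  obtain ⟨δ', hδ', hball⟩ := Metric.mem_nhdsWithin_iff.1 hnhds
  refine ⟨min δ δ', by positivity, fun u hu v hv huv hus hvs ↦ ?_⟩
  rw [lt_min_iff] at hus hvs
  have hu' : u ∈ Icc a' b' := hball ⟨by simpa [Real.dist_eq] using hus.2, hu⟩
  have hv' : v ∈ Icc a' b' := hball ⟨by simpa [Real.dist_eq] using hvs.2, hv⟩
  have hlim : ∀ s ∈ Icc a' b', ∀ m : ℝ, Tendsto (fun ε : ℝ ↦
      (extChartAt (𝓡 n) (γ s₀)).symm (c s + (ε * m) • τ)) (𝓝[>] 0) (𝓝 (γ s)) := by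
    intro s hs m
    have h1 : Continuous (fun ε : ℝ ↦ c s + (ε * m) • τ) := by fun_prop
    have h2 := h1.tendsto 0
    simp only [zero_mul, zero_smul, add_zero] at h2
    have h3 := (continuousAt_extChartAt_symm'' (hP s hs).1).tendsto.comp h2
    rw [(hP s hs).2.1] at h3
    exact h3.mono_left nhdsWithin_le_nhds
  have hsmall : ∀ᶠ ε : ℝ in 𝓝[>] 0, 0 < ε ∧ ε < δ := Ioo_mem_nhdsGT hδ
  constructor
  · intro p hp
    obtain ⟨ε, ⟨hε, hε'⟩, h1⟩ := (hsmall.and ((hlim u hu' (u - v)) (hp.mem_nhds_right hk))).exists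
    have h2 := H u v v ε hu'.1 huv hv'.2 hus.1 hvs.1 hvs.1 hε hε'
    rw [sub_self, mul_zero, zero_smul, add_zero, (hP v hv').2.1] at h2
    exact Chron.trans h1 h2.chron
  · intro q hq
    obtain ⟨ε, ⟨hε, hε'⟩, h1⟩ := (hsmall.and ((hlim v hv' (v - u)) (hq.mem_nhds_left hk))).exists
    have h2 := H u v u ε hu'.1 huv hv'.2 hus.1 hvs.1 hus.1 hε hε'
    rw [sub_self, mul_zero, zero_smul, add_zero, (hP u hu').2.1] at h2
    exact h2.chron.trans h1

/-- By compactness the interval splits into finitely many steps, each inside one neighbourhood of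
`exists_local_push_up`. -/
lemma C1Joined.push_up (hk : 1 ≤ k) (h : C1Joined n X.FutureCausal x y) :
    (∀ p, X.Chron p x → X.Chron p y) ∧ ∀ q, X.Chron y q → X.Chron x q := by
  obtain ⟨γ, a, b, hab, hγ, rfl, rfl⟩ := h
  choose! δ hδ H using fun s₀ (hs₀ : s₀ ∈ Icc a b) ↦ exists_local_push_up hk hγ hab hs₀
  obtain ⟨t, ht0, htm, ⟨m, hm⟩, hcov⟩ := exists_monotone_Icc_subset_open_cover_Icc hab.le
    (c := fun i : Icc a b ↦ Metric.ball i (δ i)) (fun i ↦ Metric.isOpen_ball)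
    (fun i _ ↦ mem_iUnion.2 ⟨i, Metric.mem_ball_self (hδ i i.2)⟩)
  have key : ∀ j, (∀ p, X.Chron p (γ a) → X.Chron p (γ (t j))) ∧
      ∀ q, X.Chron (γ (t j)) q → X.Chron (γ a) q := by
    intro j
    induction j with
    | zero => simp [ht0]
    | succ j ih =>
      rcases (htm (Nat.le_succ j)).eq_or_lt with h | h
      · rwa [Nat.succ_eq_add_one, Subtype.ext_iff.1 h] at *
      · obtain ⟨i, hi⟩ := hcov j
        have h1 := hi (left_mem_Icc.2 h.le)
        have h2 := hi (right_mem_Icc.2 h.le)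
        obtain ⟨h3, h4⟩ := H i i.2 (t j) (t j).2 (t (j + 1)) (t (j + 1)).2 h h1 h2
        exact ⟨fun p hp ↦ h3 p (ih.1 p hp), fun q hq ↦ ih.2 q (h4 q hq)⟩
  have := key m
  rwa [hm m le_rfl] at this

lemma Chron.trans_causal (hk : 1 ≤ k) (h : X.Chron p x)
    (h' : TransGen (C1Joined n X.FutureCausal) x y) : X.Chron p y := by
  induction h' with
  | single h' => exact (h'.push_up hk).1 p h
  | tail _ h' ih => exact (h'.push_up hk).1 p ih

lemma Chron.causal_trans (hk : 1 ≤ k) (h : X.Chron y q)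
    (h' : TransGen (C1Joined n X.FutureCausal) x y) : X.Chron x q := by
  induction h' with
  | single h' => exact (h'.push_up hk).2 q h
  | tail _ h' ih => exact ih ((h'.push_up hk).2 q h)

/-- Every point is in the interior of a timelike curve that stays in a given neighbourhood. -/
lemma exists_chron_near (hk : 1 ≤ k) (X : SpacetimeStructure n k M) {U : Set M} (hU : U ∈ 𝓝 x) :
    (∃ q ∈ U, X.Chron x q) ∧ ∃ p ∈ U, X.Chron p x := by
  have ht := mem_extChartAt_target (I := 𝓡 n) x
  obtain ⟨τ, hτ⟩ := exists_chartVec_eq x ht (X.T _)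
  have hP : InChart X.FutureTimelike x (extChartAt (𝓡 n) x x) τ := by
    unfold InChart
    rw [hτ]
    exact ⟨X.timelike_T _, X.timelike_T _⟩
  let c : ℝ → EuclideanSpace ℝ (Fin n) := fun s ↦ extChartAt (𝓡 n) x x + s • τ
  have hc0 : c 0 = extChartAt (𝓡 n) x x := by simp [c]
  have hc : ContDiff ℝ 1 c := by fun_prop
  have hd : derivWithin c (Icc (-1) 1) 0 = τ := by
    have := ((hasDerivAt_id (0 : ℝ)).smul_const τ).const_add (extChartAt (𝓡 n) x x)
    rw [one_smul] at this
    exact this.hasDerivWithinAt.derivWithin (uniqueDiffOn_Icc (by norm_num) 0 (by norm_num))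
  -- Used with zero displacements only: the coordinate line in the direction of `T` is timelike near
  -- `0`.
  obtain ⟨δ, hδ, H⟩ := exists_c1Joined_chart_perturbation (X := X) (x₀ := x) hk
    (hc.contDiffOn (s := Icc (-1) 1)) (by norm_num) (s₀ := 0) (by norm_num)
    (by rwa [hc0]) (by rwa [hc0, hd])
  have hlim : Tendsto (fun s ↦ (extChartAt (𝓡 n) x).symm (c s)) (𝓝 0) (𝓝 x) := by
    have h1 := hc.continuous.tendsto 0
    rw [hc0] at h1
    have h2 := (continuousAt_extChartAt_symm (I := 𝓡 n) x).tendsto.comp h1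
    rwa [extChartAt_to_inv] at h2
  have hev : ∀ᶠ s in 𝓝 (0 : ℝ), |s| < δ ∧ |s| < 1 ∧ (extChartAt (𝓡 n) x).symm (c s) ∈ U := by
    have h0 : ContinuousAt (fun s : ℝ ↦ |s|) 0 := by fun_prop
    exact (h0.eventually_lt continuousAt_const (by simpa)).and
      ((h0.eventually_lt continuousAt_const (by simp)).and (hlim hU))
  constructor
  · obtain ⟨s, hs, h1, h2, h3⟩ :=
      (eventually_nhdsWithin_of_forall (s := Ioi (0 : ℝ)) fun _ h ↦ h).and
        (hev.filter_mono nhdsWithin_le_nhds) |>.exists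
    rw [abs_lt] at h2
    obtain ⟨r, hr, H'⟩ := H 0 s (by norm_num) hs h2.2.le (by simpa) (by simpa)
    have h4 := H' 0 0 (by simpa) (by simpa)
    rw [add_zero, add_zero, hc0, extChartAt_to_inv] at h4
    exact ⟨_, h3, h4.chron⟩
  · obtain ⟨s, hs, h1, h2, h3⟩ :=
      (eventually_nhdsWithin_of_forall (s := Iio (0 : ℝ)) fun _ h ↦ h).and
        (hev.filter_mono nhdsWithin_le_nhds) |>.exists
    rw [abs_lt] at h2
    obtain ⟨r, hr, H'⟩ := H s 0 h2.1.le hs (by norm_num) (by simpa) (by simpa)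
    have h4 := H' 0 0 (by simpa) (by simpa)
    rw [add_zero, add_zero, hc0, extChartAt_to_inv] at h4
    exact ⟨_, h3, h4.chron⟩

/-! ### Compactness and the future boundary -/

/-- In a chronological spacetime, `I⁺(q)` is not contained in a compact set. -/
lemma IsChronological.exists_chron_notMem (hk : 1 ≤ k) (hX : X.IsChronological) {A : Set M}
    (hA : IsCompact (closure A)) (q : M) : ∃ z, X.Chron q z ∧ z ∉ A := by
  by_contra! hcon
  have hK : IsCompact (closure {z | X.Chron q z}) :=
    hA.of_isClosed_subset isClosed_closure (closure_mono hcon)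
  -- Covering: if `w` is in the closure and `w ≪ w'`, the neighbourhood `I⁻(w')` of `w` meets
  -- `I⁺(q)`, whence `q ≪ w'`.
  obtain ⟨F, hcov⟩ := hK.elim_finite_subcover (fun w : {w // X.Chron q w} ↦ {z | X.Chron z w})
    (fun w ↦ isOpen_iff_mem_nhds.2 fun z hz ↦ Chron.mem_nhds_left hk hz) (fun w hw ↦ by
      obtain ⟨⟨w', -, hw'⟩, -⟩ := exists_chron_near hk X (x := w) univ_mem
      obtain ⟨z, hz, hz'⟩ := mem_closure_iff_nhds.1 hw _ (hw'.mem_nhds_left hk)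
      exact mem_iUnion.2 ⟨⟨w', hz'.trans hz⟩, hw'⟩)
  have hnext : ∀ w, X.Chron q w → ∃ w' ∈ F, X.Chron w w' := fun w hw ↦ by
    simpa using hcov (subset_closure hw)
  -- The order is reversed, so that a minimal element is one with no chronological successor in `F`.
  let R : F → F → Prop := fun w w' ↦ X.Chron w'.1.1 w.1.1
  have : IsTrans F R := ⟨fun _ _ _ h h' ↦ h'.trans h⟩
  have : Std.Irrefl R := ⟨fun w ↦ hX w.1.1⟩
  obtain ⟨⟨w₀, -, hw₀⟩, -⟩ := exists_chron_near hk X (x := q) univ_mem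
  obtain ⟨w₁, hw₁, -⟩ := hnext w₀ hw₀
  obtain ⟨w, -, hw⟩ := (Finite.wellFounded_of_trans_of_irrefl R)
    |>.has_min univ ⟨⟨w₁, hw₁⟩, mem_univ _⟩
  obtain ⟨w', hw', h⟩ := hnext w.1.1 w.1.2
  exact hw ⟨w', hw'⟩ (mem_univ _) h

/-- A point of an open precompact set in a chronological spacetime has a point of the future
boundary in its future. -/
lemma IsChronological.exists_mem_futureBoundary (hk : 1 ≤ k) (hX : X.IsChronological) {A : Set M}
    (hA : IsOpen A) (hA' : IsCompact (closure A)) (hq : q ∈ A) :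
    ∃ y ∈ X.futureBoundary A, X.Chron q y := by
  obtain ⟨z, ⟨γ, a, b, hγ, rfl, rfl⟩, hz⟩ := hX.exists_chron_notMem hk hA' q
  obtain ⟨s, hs, hs'⟩ := exists_first_exit hA hγ.2.1 hγ.1.le hq hz
  have h1 : X.Chron (γ a) (γ s) :=
    chron_iff_transGen.2 (IsPiecewiseC1Curve.transGen hγ le_rfl hs.1 hs.2)
  exact ⟨γ s, ⟨hs', γ a, h1, hq⟩, h1⟩

lemma IsCausallyConvex.isAchronal_futureBoundary (hk : 1 ≤ k) {A : Set M}
    (h : X.IsCausallyConvex A) : X.IsAchronal (X.futureBoundary A) := by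
  rintro x ⟨⟨-, hx⟩, p, hpx, hp⟩ y ⟨⟨hy, -⟩, -⟩ hxy
  obtain ⟨q, hxq, hq⟩ := mem_closure_iff_nhds.1 hy _ (hxy.mem_nhds_right hk)
  obtain ⟨γ, a, b, hγ, rfl, rfl⟩ := hpx
  obtain ⟨γ', d, hbd, hγ', he, hd⟩ :=
    IsPiecewiseC1Curve.append_transGen hγ (chron_iff_transGen.1 hxq)
  have hab := hγ.1
  obtain ⟨h0, h1, m, t, h2, h3, h4, h5⟩ := hγ'
  refine h ⟨γ', a, d, ⟨h0, h1, m, t, h2, h3, h4, fun i hi ↦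
    ⟨(h5 i hi).1, fun s hs ↦ FutureTimelike.futureCausal ((h5 i hi).2 s hs)⟩⟩,
    a, ?_, b, ?_, d, ?_, hab, hbd, ?_, ?_, ?_⟩
  · exact left_mem_Icc.2 h0.le
  · exact ⟨hab.le, hbd.le⟩
  · exact right_mem_Icc.2 h0.le
  · rwa [he (left_mem_Icc.2 hab.le)]
  · rwa [he (right_mem_Icc.2 hab.le)]
  · rwa [hd]

lemma IsAchronal.isCausallyConvex (hk : 1 ≤ k) (hX : X.IsChronological) {A : Set M}
    (hA : IsOpen A) (hA' : IsCompact (closure A)) (h : X.IsAchronal (X.futureBoundary A)) :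
    X.IsCausallyConvex A := by
  rintro ⟨γ, a, b, hγ, t₁, h₁, t₂, h₂, t₃, h₃, h12, h23, hA₁, hA₂, hA₃⟩
  -- Since `s ≤ t₂ < t₃`, a nontrivial causal arc remains from the exit point back to `A`.
  obtain ⟨s, hs, hs'⟩ := exists_first_exit hA
    (hγ.2.1.mono (Icc_subset_Icc h₁.1 h₂.2)) h12.le hA₁ hA₂
  -- The timelike segments at both ends are what push-up needs to make the relations with `γ s`
  -- chronological.
  obtain ⟨-, p, hp, hp'⟩ := exists_chron_near hk X (hA.mem_nhds hA₁)
  obtain ⟨⟨q, hq, hq'⟩, -⟩ := exists_chron_near hk X (hA.mem_nhds hA₃)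
  have h1 : X.Chron p (γ s) :=
    hp'.trans_causal hk (IsPiecewiseC1Curve.transGen hγ h₁.1 hs.1 (hs.2.trans h₂.2))
  have h2 : X.Chron (γ s) q :=
    hq'.causal_trans hk (IsPiecewiseC1Curve.transGen hγ (h₁.1.trans hs.1.le)
      (hs.2.trans_lt h23) h₃.2)
  obtain ⟨y, hy, hqy⟩ := hX.exists_mem_futureBoundary hk hA hA' hq
  exact h (γ s) ⟨hs', p, h1, hp⟩ y hy (h2.trans hqy)

end

end SpacetimeStructure

end

theorem mainTheorem12 {n : ℕ} {k : ℕ∞} (hk : 1 ≤ k) {M : Type*} [TopologicalSpace M] [T2Space M]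
    [SecondCountableTopology M] [ChartedSpace (EuclideanSpace ℝ (Fin n)) M]
    [IsManifold (𝓡 n) ∞ M] (X : SpacetimeStructure n k M)
    (A : Set M) (hA : IsOpen A) (hA' : IsCompact (closure A)) :
    (X.IsCausallyConvex A → X.IsAchronal (X.futureBoundary A)) ∧
      (X.IsChronological → (X.IsCausallyConvex A ↔ X.IsAchronal (X.futureBoundary A))) :=
  ⟨fun h ↦ h.isAchronal_futureBoundary hk, fun hX ↦
    ⟨fun h ↦ h.isAchronal_futureBoundary hk, fun h ↦ h.isCausallyConvex hk hX hA hA'⟩⟩
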